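/- Let $(\Omega,\mathcal F,\mathbb P)$ be a nonatomic probability space, let $\mathcal X\subseteq L^\infty(\Omega,\mathcal F,\mathbb P)$ be a set of payoffs that contains all constants, let $n\ge 2$ and $w\in\mathbb R$. The feasible allocations are the vectors $\mathbf X=(X_1,\dots,X_n)\in\mathcal X^n$ with $\sum_{i=1}^n X_i=w$ almost surely. Let $u_1,\dots,u_n:\mathbb R\to\mathbb R$ be twice differentiable, strictly concave and increasing, and let $T:[0,1]\to[0,1]$ be strictly increasing and continuous on $[0,1]$, twice differentiable on $(0,1)$, with $T(0)=0$ and $T(1)=1$. Agent $1$ is a rank-dependent utility maximizer with $$U_1(X)=\int u_1(X)\,\mathrm d(T\circ\mathbb P)=\int_0^\infty T\big(\mathbb P(u_1(X)>t)\big)\,\mathrm dt+\int_{-\infty}^0\Big[T\big(\mathbb P(u_1(X)>t)\big)-1\Big]\,\mathrm dt$$ (Choquet integral), and agents $i=2,\dots,n$ are expected-utility maximizers with $U_i(X)=\int u_i(X)\,\mathrm d\mathbb P$. A feasible allocation $\mathbf X$ is Pareto optimal if there is no feasible allocation $\mathbf X'$ with $U_i(X_i')\ge U_i(X_i)$ for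 all $i$ and strict inequality for at least one $i$; it is a full-insurance (no-betting) allocation if every $X_i$ is almost surely constant. If $T$ is convex, then $\mathbf X$ is Pareto optimal if and only if it is a full-insurance allocation. -/

import Mathlib

open MeasureTheory Set

namespace RDUEconomy

noncomputable section

/-- A measure is nonatomic if every measurable set of positive measure contains a measurable
subset of strictly smaller positive measure. -/
def Nonatomic {Ω : Type*} [MeasurableSpace Ω] (P : Measure Ω) : Prop :=
  ∀ A : Set Ω, MeasurableSet A → 0 < P A →
    ∃ B : Set Ω, B ⊆ A ∧ MeasurableSet B ∧ 0 < P B ∧ P B < P A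

/-- Choquet integral of `Z` with respect to the normalized set function `ν`:
`∫₀^∞ ν(Z > t) dt + ∫_{-∞}^0 (ν(Z > t) - 1) dt`. -/
def choquetIntegral {Ω : Type*} (ν : Set Ω → ℝ) (Z : Ω → ℝ) : ℝ :=
  (∫ t in Ioi (0 : ℝ), ν {ω | t < Z ω}) + ∫ t in Iio (0 : ℝ), (ν {ω | t < Z ω} - 1)

/-- Probability weighting functions. Only the values of `T` on `[0,1]` matter; the conditions
force `T` to map `[0,1]` into `[0,1]`. Twice differentiability is required in the open interval
only, with continuity at the endpoints, so that weighting functions with infinite slope at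
`0` or `1` are covered too. -/
structure IsWeighting (T : ℝ → ℝ) : Prop where
  continuousOn : ContinuousOn T (Icc 0 1)
  differentiableOn : DifferentiableOn ℝ T (Ioo 0 1)
  differentiableOn_deriv : DifferentiableOn ℝ (deriv T) (Ioo 0 1)
  strictMonoOn : StrictMonoOn T (Icc 0 1)
  map_zero : T 0 = 0
  map_one : T 1 = 1

/-- Utility functions: twice differentiable, strictly concave and increasing on the real line.
(A nondecreasing strictly concave function on the line is strictly increasing.) -/
structure IsUtility (u : ℝ → ℝ) : Prop where
  differentiable : Differentiable ℝ u
  differentiable_deriv : Differentiable ℝ (deriv u)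
  strictConcave : StrictConcaveOn ℝ univ u
  monotone : Monotone u

section Economy

variable {Ω : Type*} [MeasurableSpace Ω] (P : Measure Ω)

/-- Rank-dependent utility: Choquet integral of `u(X)` with respect to `T ∘ P`. -/
def rankDependentUtility (T u : ℝ → ℝ) (X : Lp ℝ ⊤ P) : ℝ :=
  choquetIntegral (fun A => T (P.real A)) (fun ω => u (X ω))

/-- Expected utility. -/
def expectedUtility (u : ℝ → ℝ) (X : Lp ℝ ⊤ P) : ℝ :=
  ∫ ω, u (X ω) ∂P

/-- The preference functional of agent `i`: the first agent (index `0`) is the rank-dependent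
utility agent with weighting function `T`, all other agents maximize expected utility. -/
def preference {n : ℕ} (T : ℝ → ℝ) (u : Fin n → ℝ → ℝ) (i : Fin n) (X : Lp ℝ ⊤ P) : ℝ :=
  if i.val = 0 then rankDependentUtility P T (u i) X else expectedUtility P (u i) X

variable [IsFiniteMeasure P]

/-- Feasible allocations: vectors in `𝒳ⁿ` that add up (a.s.) to the constant `w`. -/
def feasible (n : ℕ) (𝒳 : Set (Lp ℝ ⊤ P)) (w : ℝ) : Set (Fin n → Lp ℝ ⊤ P) :=
  {X | (∀ i, X i ∈ 𝒳) ∧ ∑ i, X i = Lp.const ⊤ P w}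

/-- Pareto optimality of an allocation, for the preference functionals `U i`. -/
def IsParetoOptimal {n : ℕ} (𝒳 : Set (Lp ℝ ⊤ P)) (w : ℝ) (U : Fin n → Lp ℝ ⊤ P → ℝ)
    (X : Fin n → Lp ℝ ⊤ P) : Prop :=
  X ∈ feasible P n 𝒳 w ∧
    ¬ ∃ X' ∈ feasible P n 𝒳 w, (∀ i, U i (X i) ≤ U i (X' i)) ∧ ∃ i, U i (X i) < U i (X' i)

/-- Full-insurance (no-betting) allocations: feasible allocations whose components are all
(a.s.) constant. -/
def IsFullInsurance {n : ℕ} (𝒳 : Set (Lp ℝ ⊤ P)) (w : ℝ) (X : Fin n → Lp ℝ ⊤ P) : Prop :=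
  X ∈ feasible P n 𝒳 w ∧ ∀ i, ∃ c : ℝ, X i = Lp.const ⊤ P c

end Economy

end

end RDUEconomy

namespace RDUEconomy

/-! Convexity with `T 0 = 0` and `T 1 = 1` forces `T p ≤ p`, so rank-dependent utility is at most
expected utility with the same `u` (`rankDependentUtility_le_expectedUtility`). Strict Jensen then
gives every agent `U X ≤ u (E X)`, strictly unless `X` is constant (`eq_const_or_preference_lt`). As
the aggregate is the constant `w`, trading each payoff for its mean is feasible, and it is a Pareto
improvement unless all payoffs are already constant. Conversely, an allocation dominating a constant
one would need means at least as large, one strictly larger, although both families of means sum to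
`w`. -/

theorem IsUtility.strictMono {u : ℝ → ℝ} (hu : IsUtility u) : StrictMono u := by
  refine hu.monotone.strictMono_of_injective ?_
  have aux : ∀ x y : ℝ, x < y → u x ≠ u y := by
    intro x y hxy h
    have hmid := hu.strictConcave.2 (mem_univ x) (mem_univ y) hxy.ne
      (by norm_num : (0 : ℝ) < 1 / 2) (by norm_num : (0 : ℝ) < 1 / 2) (by norm_num)
    simp only [smul_eq_mul] at hmid
    have hle := hu.monotone (by linarith : 1 / 2 * x + 1 / 2 * y ≤ y)
    linarith
  intro x y h
  by_contra hne
  rcases lt_or_gt_of_ne hne with hlt | hlt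
  · exact aux x y hlt h
  · exact aux y x hlt h.symm

/-- A convex weighting function lies below the identity. -/
theorem IsWeighting.le_self {T : ℝ → ℝ} (hT : IsWeighting T) (hconv : ConvexOn ℝ (Icc 0 1) T)
    {p : ℝ} (hp0 : 0 ≤ p) (hp1 : p ≤ 1) : T p ≤ p := by
  have h := hconv.2 (by simp : (0 : ℝ) ∈ Icc (0 : ℝ) 1) (by simp : (1 : ℝ) ∈ Icc (0 : ℝ) 1)
    (by linarith : 0 ≤ 1 - p) hp0 (by ring)
  simpa [hT.map_zero, hT.map_one] using h

section Choquet

variable {Ω : Type*} [MeasurableSpace Ω] (P : Measure Ω) [IsProbabilityMeasure P]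

/-- The signed layer cake formula: the Choquet integral with respect to a probability measure is
the expectation. -/
theorem choquetIntegral_measureReal {Z : Ω → ℝ} (hZ : Integrable Z P) :
    choquetIntegral P.real Z = ∫ ω, Z ω ∂P := by
  have hneg : ∫ t in Iio (0 : ℝ), (P.real {ω | t < Z ω} - 1)
      = -∫ ω, max (-Z ω) 0 ∂P := by
    rw [hZ.neg_part.integral_eq_integral_meas_le (ae_of_all _ fun ω => le_max_right (-Z ω) 0),
      ← integral_neg, ← integral_Iic_eq_integral_Iio]
    have hflip := integral_comp_neg_Ioi 0 fun t => P.real {ω | t < Z ω} - 1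
    rw [neg_zero] at hflip
    rw [← hflip]
    refine setIntegral_congr_fun measurableSet_Ioi fun t ht => ?_
    -- After `t ↦ -t` the complement is `Z ≤ -t`, which is why the non-strict layer cake formula is
    -- used for the negative part.
    have hset : {ω | t ≤ max (-Z ω) 0} = {ω | -t < Z ω}ᶜ := by
      ext ω
      have ht' : (0 : ℝ) < t := ht
      simp only [mem_ofPred_eq, mem_compl_iff, not_lt, le_max_iff]
      constructor
      · rintro (h | h) <;> linarith
      · intro h
        left
        linarith
    have hms : NullMeasurableSet {ω | -t < Z ω} P :=
      nullMeasurableSet_lt aemeasurable_const hZ.aemeasurable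
    simp only [hset, probReal_compl_eq_one_sub₀ hms]
    ring
  have hpos : ∫ t in Ioi (0 : ℝ), P.real {ω | t < Z ω} = ∫ ω, max (Z ω) 0 ∂P := by
    rw [hZ.pos_part.integral_eq_integral_meas_lt (ae_of_all _ fun ω => le_max_right (Z ω) 0)]
    refine setIntegral_congr_fun measurableSet_Ioi fun t ht => ?_
    have ht' : (0 : ℝ) < t := ht
    simp only [lt_max_iff, not_lt_of_gt ht', or_false]
  rw [choquetIntegral, hpos, hneg, ← sub_eq_add_neg, ← integral_sub hZ.pos_part hZ.neg_part]
  refine integral_congr_ae (ae_of_all _ fun ω => ?_)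
  rcases le_total (Z ω) 0 with h | h
  · simp [h]
  · simp [h]

/-- Distorting the probability of a level set by a monotone function is an antitone function of
the level. -/
theorem antitone_distorted_tail {T : ℝ → ℝ} (hT : MonotoneOn T (Icc 0 1)) (Z : Ω → ℝ) :
    Antitone fun t => T (P.real {ω | t < Z ω}) := fun _ _ hst =>
  hT ⟨measureReal_nonneg, measureReal_le_one⟩ ⟨measureReal_nonneg, measureReal_le_one⟩
    (measureReal_mono fun _ hω => lt_of_le_of_lt hst hω)

/-- Antitone functions are locally integrable, and this one vanishes beyond the essential bound `M`.
Comparing Choquet integrals needs this, since the integral of a non-integrable function is `0` by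
convention. -/
theorem integrableOn_distorted_upper_tail {T : ℝ → ℝ} (hT : MonotoneOn T (Icc 0 1))
    (hT0 : T 0 = 0) {Z : Ω → ℝ} {M : ℝ} (hM : ∀ᵐ ω ∂P, |Z ω| ≤ M) :
    IntegrableOn (fun t => T (P.real {ω | t < Z ω})) (Ioi 0) := by
  have hloc := (antitone_distorted_tail P hT Z).locallyIntegrable (μ := volume)
  refine ((hloc.integrableOn_isCompact (isCompact_Icc (a := 0) (b := M))).of_forall_sdiff_eq_zero
    measurableSet_Ioi ?_)
  rintro t ⟨ht0, ht⟩
  have htM : M < t := by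
    by_contra h
    exact ht ⟨le_of_lt ht0, not_lt.1 h⟩
  have hnull : P {ω | t < Z ω} = 0 := by
    refine measure_mono_null (fun ω hω => ?_) (ae_iff.1 hM)
    have h' : t < Z ω := hω
    exact not_le.2 (by linarith [le_abs_self (Z ω)])
  simp [measureReal_def, hnull, hT0]

theorem integrableOn_distorted_lower_tail {T : ℝ → ℝ} (hT : MonotoneOn T (Icc 0 1))
    (hT1 : T 1 = 1) {Z : Ω → ℝ} {M : ℝ} (hM : ∀ᵐ ω ∂P, |Z ω| ≤ M) :
    IntegrableOn (fun t => T (P.real {ω | t < Z ω}) - 1) (Iio 0) := by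
  have hloc := ((antitone_distorted_tail P hT Z).add_const (-1)).locallyIntegrable (μ := volume)
  simp only [← sub_eq_add_neg] at hloc
  refine ((hloc.integrableOn_isCompact (isCompact_Icc (a := -M)
    (b := 0))).of_forall_sdiff_eq_zero measurableSet_Iio ?_)
  rintro t ⟨ht0, ht⟩
  have htM : t < -M := by
    by_contra h
    exact ht ⟨not_lt.1 h, le_of_lt ht0⟩
  have hfull : P {ω | t < Z ω} = 1 := by
    rw [← measure_univ (μ := P)]
    refine measure_congr ?_
    filter_upwards [hM] with ω hω
    refine eq_true (?_ : t < Z ω) |>.trans (eq_true (mem_univ ω)).symm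
    linarith [neg_abs_le (Z ω)]
  simp [measureReal_def, hfull, hT1]

/-- The Choquet integral of an essentially bounded function is monotone in the distortion. -/
theorem choquetIntegral_mono_distortion {S T : ℝ → ℝ} (hS : MonotoneOn S (Icc 0 1))
    (hT : MonotoneOn T (Icc 0 1)) (hS0 : S 0 = 0) (hS1 : S 1 = 1) (hT0 : T 0 = 0) (hT1 : T 1 = 1)
    (hST : ∀ p ∈ Icc (0 : ℝ) 1, S p ≤ T p)
    {Z : Ω → ℝ} {M : ℝ} (hM : ∀ᵐ ω ∂P, |Z ω| ≤ M) :
    choquetIntegral (fun A => S (P.real A)) Z ≤ choquetIntegral (fun A => T (P.real A)) Z := by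
  have hle : ∀ A : Set Ω, S (P.real A) ≤ T (P.real A) := fun A =>
    hST _ ⟨measureReal_nonneg, measureReal_le_one⟩
  exact add_le_add
    (integral_mono (integrableOn_distorted_upper_tail P hS hS0 hM)
      (integrableOn_distorted_upper_tail P hT hT0 hM) fun t => hle _)
    (integral_mono (integrableOn_distorted_lower_tail P hS hS1 hM)
      (integrableOn_distorted_lower_tail P hT hT1 hM) fun t => sub_le_sub_right (hle _) 1)

/-- The Choquet integral of an almost surely constant function is that constant. -/
theorem choquetIntegral_of_ae_eq_const {T : ℝ → ℝ} (hT0 : T 0 = 0) (hT1 : T 1 = 1)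
    {Z : Ω → ℝ} {c : ℝ} (hZ : ∀ᵐ ω ∂P, Z ω = c) :
    choquetIntegral (fun A => T (P.real A)) Z = c := by
  -- All tail probabilities are `0` or `1`, both fixed by `T`, so the distortion disappears and the
  -- layer cake formula applies.
  have hval : ∀ t, T (P.real {ω | t < Z ω}) = P.real {ω | t < Z ω} := by
    intro t
    have hcongr : P.real {ω | t < Z ω} = P.real {_ω : Ω | t < c} := by
      refine measureReal_congr ?_
      filter_upwards [hZ] with ω hω
      exact congrArg (fun z => t < z) hω
    by_cases h : t < c <;> simp [hcongr, h, hT0, hT1]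
  have hint : Integrable Z P := (integrable_const c).congr (hZ.mono fun ω hω => hω.symm)
  have h := choquetIntegral_measureReal P hint
  rw [integral_congr_ae hZ, integral_const, probReal_univ, one_smul] at h
  simpa only [choquetIntegral, hval] using h

end Choquet

section Allocations

variable {Ω : Type*} [MeasurableSpace Ω] (P : Measure Ω)

theorem exists_ae_abs_le (X : Lp ℝ ⊤ P) : ∃ M : ℝ, ∀ᵐ ω ∂P, |X ω| ≤ M :=
  by
  refine ⟨(eLpNormEssSup X P).toReal, ?_⟩
  have hfin : eLpNormEssSup X P < ⊤ := by
    simpa only [eLpNorm_exponent_top] using Lp.eLpNorm_lt_top X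
  filter_upwards [ae_le_eLpNormEssSup (f := X) (μ := P)] with ω hω
  simpa using ENNReal.toReal_mono hfin.ne hω

theorem exists_ae_abs_comp_le {u : ℝ → ℝ} (hu : Continuous u) (X : Lp ℝ ⊤ P) :
    ∃ M : ℝ, ∀ᵐ ω ∂P, |u (X ω)| ≤ M := by
  obtain ⟨M, hM⟩ := exists_ae_abs_le P X
  obtain ⟨C, hC⟩ := (isCompact_Icc (a := -M) (b := M)).exists_bound_of_continuousOn hu.continuousOn
  exact ⟨C, hM.mono fun ω hω => hC _ (abs_le.1 hω)⟩

variable [IsProbabilityMeasure P]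

theorem integrable_comp_linfty {u : ℝ → ℝ} (hu : Continuous u) (X : Lp ℝ ⊤ P) :
    Integrable (fun ω => u (X ω)) P := by
  obtain ⟨M, hM⟩ := exists_ae_abs_comp_le P hu X
  exact Integrable.of_bound (hu.comp_aestronglyMeasurable (Lp.aestronglyMeasurable X)) M hM

theorem integrable_linfty (X : Lp ℝ ⊤ P) : Integrable X P :=
  integrable_comp_linfty P continuous_id X

/-- The expectation as an additive map on `L^∞`. -/
noncomputable def mean : Lp ℝ ⊤ P →+ ℝ :=
  AddMonoidHom.mk' (fun X => ∫ ω, X ω ∂P) fun X Y => by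
    rw [integral_congr_ae (Lp.coeFn_add X Y)]
    exact integral_add (integrable_linfty P X) (integrable_linfty P Y)

theorem mean_const (c : ℝ) : mean P (Lp.const ⊤ P c) = c := by
  change ∫ ω, (Lp.const ⊤ P c : Lp ℝ ⊤ P) ω ∂P = c
  rw [integral_congr_ae (Lp.coeFn_const _ _ _)]
  simp

theorem sum_mean_of_feasible {n : ℕ} {𝒳 : Set (Lp ℝ ⊤ P)} {w : ℝ} {X : Fin n → Lp ℝ ⊤ P}
    (hX : X ∈ feasible P n 𝒳 w) : ∑ i, mean P (X i) = w := by
  rw [← map_sum, hX.2, mean_const]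

/-- Strict Jensen inequality for expected utility. -/
theorem eq_const_or_expectedUtility_lt {u : ℝ → ℝ} (hu : IsUtility u) (X : Lp ℝ ⊤ P) :
    X = Lp.const ⊤ P (mean P X) ∨ expectedUtility P u X < u (mean P X) := by
  have hc := hu.differentiable.continuous
  have h := hu.strictConcave.ae_eq_const_or_lt_map_average hc.continuousOn isClosed_univ
    (ae_of_all _ fun ω => mem_univ (X ω)) (integrable_linfty P X)
    (integrable_comp_linfty P hc X)
  rw [average_eq_integral, average_eq_integral] at h
  exact h.imp_left fun h => Lp.ext (h.trans (Lp.coeFn_const _ _ _).symm)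

theorem rankDependentUtility_le_expectedUtility {T u : ℝ → ℝ} (hT : IsWeighting T)
    (hconv : ConvexOn ℝ (Icc 0 1) T) (hu : Continuous u) (X : Lp ℝ ⊤ P) :
    rankDependentUtility P T u X ≤ expectedUtility P u X := by
  obtain ⟨M, hM⟩ := exists_ae_abs_comp_le P hu X
  rw [expectedUtility, ← choquetIntegral_measureReal P (integrable_comp_linfty P hu X)]
  exact choquetIntegral_mono_distortion P (T := fun p => p) hT.strictMonoOn.monotoneOn
    (monotone_id.monotoneOn _) hT.map_zero hT.map_one rfl rfl
    (fun p hp => hT.le_self hconv hp.1 hp.2) hM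

theorem preference_const {n : ℕ} {T : ℝ → ℝ} (hT : IsWeighting T) (u : Fin n → ℝ → ℝ) (i : Fin n) (c : ℝ) :
    preference P T u i (Lp.const ⊤ P c) = u i c := by
  have hc : ∀ᵐ ω ∂P, u i ((Lp.const ⊤ P c : Lp ℝ ⊤ P) ω) = u i c :=
    (Lp.coeFn_const ⊤ P c).mono fun ω hω => congrArg (u i) hω
  unfold preference
  split_ifs
  · exact choquetIntegral_of_ae_eq_const P hT.map_zero hT.map_one hc
  · rw [expectedUtility, integral_congr_ae hc]
    simp

theorem preference_le_expectedUtility {n : ℕ} {T : ℝ → ℝ} (hT : IsWeighting T)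
    (hconv : ConvexOn ℝ (Icc 0 1) T) {u : Fin n → ℝ → ℝ} {i : Fin n} (hu : Continuous (u i))
    (X : Lp ℝ ⊤ P) : preference P T u i X ≤ expectedUtility P (u i) X := by
  unfold preference
  split_ifs
  · exact rankDependentUtility_le_expectedUtility P hT hconv hu X
  · exact le_rfl

/-- Every agent weakly prefers the mean of a payoff to the payoff, strictly so unless the payoff
is constant. -/
theorem eq_const_or_preference_lt {n : ℕ} {T : ℝ → ℝ} (hT : IsWeighting T)
    (hconv : ConvexOn ℝ (Icc 0 1) T) {u : Fin n → ℝ → ℝ} {i : Fin n} (hu : IsUtility (u i))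
    (X : Lp ℝ ⊤ P) :
    X = Lp.const ⊤ P (mean P X) ∨ preference P T u i X < u i (mean P X) :=
  (eq_const_or_expectedUtility_lt P hu X).imp_right
    (preference_le_expectedUtility P hT hconv hu.differentiable.continuous X).trans_lt

theorem preference_le_mean {n : ℕ} {T : ℝ → ℝ} (hT : IsWeighting T)
    (hconv : ConvexOn ℝ (Icc 0 1) T) {u : Fin n → ℝ → ℝ} {i : Fin n} (hu : IsUtility (u i))
    (X : Lp ℝ ⊤ P) : preference P T u i X ≤ u i (mean P X) := by
  rcases eq_const_or_preference_lt P hT hconv hu X with h | h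
  · rw [← preference_const P hT u i (mean P X), ← h]
  · exact h.le

end Allocations

end RDUEconomy

theorem corollary3p7 {Ω : Type*} [MeasurableSpace Ω] (P : Measure Ω) [IsProbabilityMeasure P]
    (hP : RDUEconomy.Nonatomic P)
    (𝒳 : Set (Lp ℝ ⊤ P)) (h𝒳 : ∀ c : ℝ, Lp.const ⊤ P c ∈ 𝒳)
    (n : ℕ) (hn : 2 ≤ n) (w : ℝ)
    (T : ℝ → ℝ) (hT : RDUEconomy.IsWeighting T)
    (u : Fin n → ℝ → ℝ) (hu : ∀ i, RDUEconomy.IsUtility (u i))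
    (hconv : ConvexOn ℝ (Icc 0 1) T)
    (X : Fin n → Lp ℝ ⊤ P) :
    RDUEconomy.IsParetoOptimal P 𝒳 w (RDUEconomy.preference P T u) X ↔
      RDUEconomy.IsFullInsurance P 𝒳 w X := by
  constructor
  · rintro ⟨hX, hopt⟩
    refine ⟨hX, fun i => ?_⟩
    by_contra hi
    -- The improvement gives each agent the mean of their payoff; agent `i`, whose payoff is not
    -- constant, gains strictly.
    refine hopt ⟨fun j => Lp.const ⊤ P (RDUEconomy.mean P (X j)), ⟨fun j => h𝒳 _, ?_⟩,
      fun j => ?_, i, ?_⟩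
    · rw [← map_sum, RDUEconomy.sum_mean_of_feasible P hX]
    · rw [RDUEconomy.preference_const P hT]
      exact RDUEconomy.preference_le_mean P hT hconv (hu j) (X j)
    · rw [RDUEconomy.preference_const P hT]
      exact (RDUEconomy.eq_const_or_preference_lt P hT hconv (hu i) (X i)).resolve_left
        fun h => hi ⟨_, h⟩
  · rintro ⟨hX, hconst⟩
    refine ⟨hX, ?_⟩
    rintro ⟨Y, hY, hle, i, hlt⟩
    have hpref : ∀ j, RDUEconomy.preference P T u j (X j) = u j (RDUEconomy.mean P (X j)) := by
      intro j
      obtain ⟨c, hc⟩ := hconst j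
      rw [hc, RDUEconomy.preference_const P hT, RDUEconomy.mean_const]
    have hYle := fun j => RDUEconomy.preference_le_mean P hT hconv (hu j) (Y j)
    -- Strict monotonicity of `u j` turns utility comparisons into comparisons of means.
    have hsum : ∑ j, RDUEconomy.mean P (X j) < ∑ j, RDUEconomy.mean P (Y j) :=
      Finset.sum_lt_sum
        (fun j _ => (hu j).strictMono.le_iff_le.1 (((hpref j).ge.trans (hle j)).trans (hYle j)))
        ⟨i, Finset.mem_univ i,
          (hu i).strictMono.lt_iff_lt.1 (((hpref i).ge.trans_lt hlt).trans_le (hYle i))⟩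
    rw [RDUEconomy.sum_mean_of_feasible P hX, RDUEconomy.sum_mean_of_feasible P hY] at hsum
    exact hsum.false
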